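/- Consider a sequence, indexed by $n\ge 1$, of multiclass multi-pool networks with finite sets of customer classes $\mathcal I=\{1,\dots,I\}$ and server pools $\mathcal J=\{1,\dots,J\}$. Let $\mathcal E\subset\mathcal I\times\mathcal J$ be the set of pairs $(i,j)$ such that pool $j$ can serve class $i$; write $i\sim j$ for $(i,j)\in\mathcal E$ and $\mathcal J(i)=\{j: i\sim j\}$, and assume that the bipartite graph $(\mathcal I\cup\mathcal J,\mathcal E)$ is a tree. The $n$-th system has arrival rates $\lambda_i^n>0$, service rates $\mu_{ij}^n>0$ for $i\sim j$, and positive integer numbers of servers $N_j^n$. Assume (Halfin--Whitt regime) that, as $n\to\infty$, $\lambda_i^n/n\to\lambda_i>0$, $N_j^n/n\to\nu_j>0$, $\mu_{ij}^n\to\mu_{ij}>0$, $(\lambda_i^n-n\lambda_i)/\sqrt n\to\hat\lambda_i$, $\sqrt n(\mu_{ij}^n-\mu_{ij})\to\hat\mu_{ij}$ and $\sqrt n(n^{-1}N_j^n-\nu_j)\to\hat\nu_j$ (with real limits). Assume also complete resource pooling: the problem of minimizing $\max_j\sum_i\xi_{ij}$ over nonnegative $\xi\in\mathbb R^{I\times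 J}$ with $\xi_{ij}=0$ for $i\nsim j$ and $\sum_j\mu_{ij}\nu_j\xi_{ij}=\lambda_i$ for all $i$ has a unique solution $\xi^*$, which satisfies $\sum_i\xi^*_{ij}=1$ for all $j$ and $\xi^*_{ij}>0$ for $i\sim j$. Let $e$ denote the all-ones vector, $\Delta_I$ and $\Delta_J$ the sets of probability vectors in $\mathbb R^I$ and $\mathbb R^J$, and $a^\pm=\max(\pm a,0)$. For $\alpha\in\mathbb R^I$, $\beta\in\mathbb R^J$ with $\langle e,\alpha\rangle=\langle e,\beta\rangle$ let $\Psi(\alpha,\beta)\in\mathbb R^{I\times J}$ be the unique array with $\Psi_{ij}=0$ for $i\nsim j$, row sums $\sum_j\Psi_{ij}=\alpha_i$ and column sums $\sum_i\Psi_{ij}=\beta_j$. The limiting controlled diffusion has the drift $$b_i(x,u)=h_i-\sum_{j\in\mathcal J(i)}\mu_{ij}\Psi_{ij}\bigl(x-\langle e,x\rangle^+u^c,\,-\langle e,x\rangle^-u^s\bigr),\qquad x\in\mathbb R^I,\ u=(u^c,u^s)\in\Delta_I\times\Delta_J,$$ where $h_i=\hat\lambda_i-\sum_{j\in\mathcal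 J(i)}(\mu_{ij}\xi^*_{ij}\hat\nu_j+\hat\mu_{ij}\xi^*_{ij}\nu_j)$. Fix any pool $\hat\jmath\in\mathcal J$. (1) There are matrices $B_1\in\mathbb R^{I\times I}$, $B_2\in\mathbb R^{I\times J}$ such that the $\hat\jmath$-th column of $B_2$ is zero and $$b(x,u)=h-B_1\bigl(x-\langle e,x\rangle^+u^c\bigr)+\langle e,x\rangle^-B_2u^s\qquad\text{for all }x\in\mathbb R^I,\ u\in\Delta_I\times\Delta_J.$$ For any such $B_1,B_2$, the matrix $B_1$ is invertible and $$\inf_{u^s\in\Delta_J}\bigl(1+\langle e,B_1^{-1}B_2u^s\rangle\bigr)>0.$$ (2) For every $n\ge1$ there are matrices $B_1^n\in\mathbb R^{I\times I}$, $B_2^n\in\mathbb R^{I\times J}$ such that the $\hat\jmath$-th column of $B_2^n$ is zero and $$\sum_{j\in\mathcal J(i)}\mu^n_{ij}\Psi_{ij}(\alpha,\beta)=(B_1^n\alpha+B_2^n\beta)_i\qquad\text{for all }i\in\mathcal I\text{ and all }(\alpha,\beta)\text{ with }\langle e,\alpha\rangle=\langle e,\beta\rangle.$$ For any such $B_1^n,B_2^n$,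 the matrix $B_1^n$ is invertible and $$\inf_{u^s\in\Delta_J}\bigl(1+\langle e,(B_1^n)^{-1}B_2^nu^s\rangle\bigr)>0.$$ -/

import Mathlib

open Filter Topology Matrix

namespace PSN

variable {I J : Type*} [Fintype I] [Fintype J] [DecidableEq I] [DecidableEq J]

/-- The bipartite graph on classes `I` and server pools `J` with edge set `E ⊆ I × J`. -/
def bipartiteGraph (E : Finset (I × J)) : SimpleGraph (I ⊕ J) where
  Adj v w := (∃ i j, v = Sum.inl i ∧ w = Sum.inr j ∧ (i, j) ∈ E) ∨
    (∃ i j, v = Sum.inr j ∧ w = Sum.inl i ∧ (i, j) ∈ E)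
  symm := ⟨by
    rintro v w (⟨i, j, hv, hw, h⟩ | ⟨i, j, hv, hw, h⟩)
    · exact Or.inr ⟨i, j, hw, hv, h⟩
    · exact Or.inl ⟨i, j, hw, hv, h⟩⟩
  loopless := ⟨by
    rintro v (⟨i, j, hv, hw, -⟩ | ⟨i, j, hv, hw, -⟩) <;> simp [hv] at hw⟩

/-- `𝒥(i)`: the pools that can serve class `i`. -/
def pools (E : Finset (I × J)) (i : I) : Finset J := {j | (i, j) ∈ E}

/-- `ℝ^𝒢`: the real `I × J` arrays that vanish off the edges. -/
def supportedOn (E : Finset (I × J)) : Set (I → J → ℝ) :=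
  {ξ | ∀ i j, (i, j) ∉ E → ξ i j = 0}

/-- Feasibility for the linear program `minimize max_j ∑ i, ξ i j` over `ξ ∈ ℝ^𝒢₊`
subject to `∑ j, μ i j * ν j * ξ i j = lam i`. -/
def LPFeasible (E : Finset (I × J)) (lam : I → ℝ) (ν : J → ℝ) (μ : I → J → ℝ)
    (ξ : I → J → ℝ) : Prop :=
  ξ ∈ supportedOn E ∧ (∀ i j, 0 ≤ ξ i j) ∧
    ∀ i, ∑ j ∈ pools E i, μ i j * ν j * ξ i j = lam i

/-- Optimality for that linear program. -/
def LPOptimal (E : Finset (I × J)) (lam : I → ℝ) (ν : J → ℝ) (μ : I → J → ℝ)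
    (ξ : I → J → ℝ) : Prop :=
  LPFeasible E lam ν μ ξ ∧
    ∀ ξ', LPFeasible E lam ν μ ξ' → (⨆ j, ∑ i, ξ i j) ≤ ⨆ j, ∑ i, ξ' i j

/-- A sequence of multiclass multi-pool networks, indexed by `n ≥ 1`, in the Halfin--Whitt
regime, on a tree, under complete resource pooling. Service rates off the edges are
irrelevant. -/
structure Network (I J : Type*) [Fintype I] [Fintype J] [DecidableEq I] [DecidableEq J] where
  /-- the edges of the graph -/
  E : Finset (I × J)
  isTree : (bipartiteGraph E).IsTree
  /-- arrival rates, service rates and numbers of servers of the `n`-th system -/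
  lamN : ℕ → I → ℝ
  μN : ℕ → I → J → ℝ
  serversN : ℕ → J → ℕ
  lamN_pos : ∀ n, 1 ≤ n → ∀ i, 0 < lamN n i
  μN_pos : ∀ n, 1 ≤ n → ∀ i j, (i, j) ∈ E → 0 < μN n i j
  serversN_pos : ∀ n, 1 ≤ n → ∀ j, 0 < serversN n j
  /-- first-order limits -/
  lam : I → ℝ
  μ : I → J → ℝ
  ν : J → ℝ
  lam_pos : ∀ i, 0 < lam i
  μ_pos : ∀ i j, (i, j) ∈ E → 0 < μ i j
  ν_pos : ∀ j, 0 < ν j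
  tendsto_lam : ∀ i, Tendsto (fun n : ℕ => lamN n i / n) atTop (𝓝 (lam i))
  tendsto_ν : ∀ j, Tendsto (fun n : ℕ => (serversN n j : ℝ) / n) atTop (𝓝 (ν j))
  tendsto_μ : ∀ i j, (i, j) ∈ E → Tendsto (fun n : ℕ => μN n i j) atTop (𝓝 (μ i j))
  /-- second-order limits -/
  lamHat : I → ℝ
  μHat : I → J → ℝ
  νHat : J → ℝ
  tendsto_lamHat : ∀ i,
    Tendsto (fun n : ℕ => (lamN n i - n * lam i) / Real.sqrt n) atTop (𝓝 (lamHat i))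
  tendsto_μHat : ∀ i j, (i, j) ∈ E →
    Tendsto (fun n : ℕ => Real.sqrt n * (μN n i j - μ i j)) atTop (𝓝 (μHat i j))
  tendsto_νHat : ∀ j,
    Tendsto (fun n : ℕ => Real.sqrt n * ((serversN n j : ℝ) / n - ν j)) atTop (𝓝 (νHat j))
  /-- complete resource pooling: the linear program has the unique solution `ξ`, ... -/
  ξ : I → J → ℝ
  ξ_optimal : LPOptimal E lam ν μ ξ
  ξ_unique : ∀ ξ', LPOptimal E lam ν μ ξ' → ξ' = ξ
  /-- ... which is critically loaded and positive on the edges -/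
  ξ_sum : ∀ j, ∑ i, ξ i j = 1
  ξ_pos : ∀ i j, (i, j) ∈ E → 0 < ξ i j

/-- `ψ ∈ ℝ^𝒢` has row sums `α` and column sums `β`. -/
def HasMarginals (E : Finset (I × J)) (α : I → ℝ) (β : J → ℝ) (ψ : I → J → ℝ) : Prop :=
  ψ ∈ supportedOn E ∧ (∀ i, ∑ j, ψ i j = α i) ∧ ∀ j, ∑ i, ψ i j = β j

open Classical in
/-- The map `Ψ`: the array in `ℝ^𝒢` with row sums `α` and column sums `β`. On a tree it exists
and is unique whenever `∑ α = ∑ β`; in the remaining cases the value is `0` by convention. -/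
noncomputable def Psi (E : Finset (I × J)) (α : I → ℝ) (β : J → ℝ) : I → J → ℝ :=
  if h : ∃ ψ, HasMarginals E α β ψ then h.choose else 0

namespace Network

variable (S : Network I J)

/-- The constant term `h` of the limiting drift; note `z*_{ij} = ξ*_{ij} ν_j`. -/
noncomputable def h (i : I) : ℝ :=
  S.lamHat i - ∑ j ∈ pools S.E i,
    (S.μ i j * S.ξ i j * S.νHat j + S.μHat i j * (S.ξ i j * S.ν j))

/-- The drift `b(x, (uᶜ, uˢ))` of the limiting controlled diffusion. -/
noncomputable def drift (x : I → ℝ) (uc : I → ℝ) (us : J → ℝ) (i : I) : ℝ :=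
  S.h i - ∑ j ∈ pools S.E i,
    S.μ i j * Psi S.E (x - (∑ k, x k)⁺ • uc) (-((∑ k, x k)⁻ • us)) i j

/-- `B₁, B₂` represent the limiting drift as
`b(x, u) = h - B₁ (x - ⟨e, x⟩⁺ uᶜ) + ⟨e, x⟩⁻ B₂ uˢ`, normalized so that the column of `B₂` that
belongs to the pool `j₀` vanishes. -/
def IsDriftPair (j₀ : J) (B₁ : Matrix I I ℝ) (B₂ : Matrix I J ℝ) : Prop :=
  (∀ x : I → ℝ, ∀ uc ∈ stdSimplex ℝ I, ∀ us ∈ stdSimplex ℝ J,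
    S.drift x uc us =
      S.h - B₁ *ᵥ (x - (∑ k, x k)⁺ • uc) + (∑ k, x k)⁻ • (B₂ *ᵥ us)) ∧
  ∀ i, B₂ i j₀ = 0

/-- `B₁ⁿ, B₂ⁿ` represent the linear part of the drift of the `n`-th system:
`∑ j ∈ 𝒥(i), μⁿ i j * Ψ(α, β) i j = (B₁ⁿ α + B₂ⁿ β) i` whenever `∑ α = ∑ β`, normalized so that
the column of `B₂ⁿ` that belongs to the pool `j₀` vanishes. -/
def IsPrelimitDriftPair (n : ℕ) (j₀ : J) (B₁ : Matrix I I ℝ) (B₂ : Matrix I J ℝ) : Prop :=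
  (∀ (α : I → ℝ) (β : J → ℝ), ∑ i, α i = ∑ j, β j →
    ∀ i, ∑ j ∈ pools S.E i, S.μN n i j * Psi S.E α β i j = (B₁ *ᵥ α + B₂ *ᵥ β) i) ∧
  ∀ i, B₂ i j₀ = 0

end Network

end PSN

/-! On a tree, `log μ i j` splits as `p i + q j`, so there are `v` and a positive `d` with `v i * μ
i j = d j` on the edges and `d j₀ = 1` (`exists_balancing`). Weighting the classes by `v` turns the
total service rate of an array with column sums `β` into `⟨d, β⟩`. Testing on unit marginals gives
`vᵀ B₁ = eᵀ` and `vᵀ B₂ = (d - e)ᵀ`, hence `1 + ⟨e, B₁⁻¹ B₂ u⟩ = ⟨d, u⟩ ≥ min d > 0` on the simplex.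

For invertibility, let `B₁ α = 0` and take the array `ψ` with row sums `α` and all column mass at
`j₀`. Its service rates vanish, so pairing with `v` gives `⟨e, α⟩ = 0`. Then `d j * ψ i j` has zero
marginals, and such an array on a tree is zero (`HasMarginals.eq_zero`); thus `α = 0`.

Only unit marginals enter, so one argument covers the limit and every prelimit system. -/

namespace SimpleGraph

variable {V : Type*} {G : SimpleGraph V}

/-- An antisymmetric weight on the edges of a tree is the difference of a potential. -/
theorem IsTree.exists_potential {A : Type*} [AddCommGroup A] (hG : G.IsTree) (w : V → V → A)
    (hw : ∀ u v, w v u = -w u v) : ∃ f : V → A, ∀ u v, G.Adj u v → f v - f u = w u v := by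
  obtain ⟨r⟩ := hG.connected.nonempty
  choose P hP _ using hG.existsUnique_path r
  -- The potential at `v` is the sum of the weights along the path from the root `r`.
  let f : V → A := fun v => ((P v).darts.map fun d => w d.fst d.snd).sum
  have step : ∀ u v, G.Adj u v → u ∈ (P v).support → f v - f u = w u v := by
    intro u v h hu
    have hc : P v = (P u).concat h := hG.isAcyclic.path_concat (hP u) (hP v) h hu
    simp [f, hc, Walk.darts_concat]
  refine ⟨f, fun u v h => ?_⟩
  -- In a tree, one end of an edge lies on the root path of the other; antisymmetry of `w` reduces
  -- both cases to `step`.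
  by_cases hu : u ∈ (P v).support
  · exact step u v h hu
  · have hv := hG.isAcyclic.mem_support_of_ne_mem_support_of_adj_of_isPath (hP u) (hP v) h hu
    rw [← neg_sub, step v u h.symm hv, hw u v, neg_neg]

end SimpleGraph

/-! ### Potentials and arrays with prescribed marginals -/

namespace PSN

section Marginals

variable {I J : Type*} {E : Finset (I × J)}

theorem bipartiteGraph_adj_inl_inr {i : I} {j : J} :
    (bipartiteGraph E).Adj (Sum.inl i) (Sum.inr j) ↔ (i, j) ∈ E := by
  constructor
  · rintro (⟨i', j', hi, hj, h⟩ | ⟨i', j', hi, hj, h⟩)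
    · cases hi; cases hj; exact h
    · cases hi
  · exact fun h => Or.inl ⟨i, j, rfl, rfl, h⟩

/-- Every array on the edges of a bipartite tree is a sum of a row and a column potential. -/
theorem exists_add_potential (hE : (bipartiteGraph E).IsTree) (a : I → J → ℝ) :
    ∃ (p : I → ℝ) (q : J → ℝ), ∀ i j, (i, j) ∈ E → p i + q j = a i j := by
  obtain ⟨f, hf⟩ := hE.exists_potential
    (fun u v => match u, v with
      | Sum.inl i, Sum.inr j => a i j
      | Sum.inr j, Sum.inl i => -a i j
      | _, _ => 0)
    (by rintro (i | j) (i' | j') <;> simp)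
  refine ⟨fun i => -f (Sum.inl i), fun j => f (Sum.inr j), fun i j h => ?_⟩
  have := hf _ _ (bipartiteGraph_adj_inl_inr.2 h)
  dsimp only at this
  linarith

/-- Positive weights on the edges of a bipartite tree can be balanced by positive multipliers of
the rows to weights that depend on the column only. -/
theorem exists_balancing (hE : (bipartiteGraph E).IsTree) {μ : I → J → ℝ}
    (hμ : ∀ i j, (i, j) ∈ E → 0 < μ i j) (j₀ : J) :
    ∃ (v : I → ℝ) (d : J → ℝ), (∀ j, 0 < d j) ∧ d j₀ = 1 ∧
      ∀ i j, (i, j) ∈ E → v i * μ i j = d j := by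
  obtain ⟨p, q, hpq⟩ := exists_add_potential hE fun i j => Real.log (μ i j)
  refine ⟨fun i => Real.exp (-p i - q j₀), fun j => Real.exp (q j - q j₀),
    fun j => Real.exp_pos _, by simp, fun i j h => ?_⟩
  have := Real.exp_log (hμ i j h)
  rw [← hpq i j h] at this
  rw [← this, ← Real.exp_add]
  ring_nf

variable [Fintype I] [Fintype J]

namespace HasMarginals

variable {α α' : I → ℝ} {β β' : J → ℝ} {ψ ψ' : I → J → ℝ}

theorem zero : HasMarginals E 0 0 (0 : I → J → ℝ) :=
  ⟨fun _ _ _ => rfl, by simp, by simp⟩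

theorem add (h : HasMarginals E α β ψ) (h' : HasMarginals E α' β' ψ') :
    HasMarginals E (α + α') (β + β') (ψ + ψ') :=
  ⟨fun i j hij => by simp [h.1 i j hij, h'.1 i j hij],
    fun i => by simp [Finset.sum_add_distrib, h.2.1, h'.2.1],
    fun j => by simp [Finset.sum_add_distrib, h.2.2, h'.2.2]⟩

theorem smul (c : ℝ) (h : HasMarginals E α β ψ) : HasMarginals E (c • α) (c • β) (c • ψ) :=
  ⟨fun i j hij => by simp [h.1 i j hij],
    fun i => by simp [← Finset.mul_sum, h.2.1],
    fun j => by simp [← Finset.mul_sum, h.2.2]⟩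

theorem neg (h : HasMarginals E α β ψ) : HasMarginals E (-α) (-β) (-ψ) := by
  simpa using h.smul (-1)

theorem sub (h : HasMarginals E α β ψ) (h' : HasMarginals E α' β' ψ') :
    HasMarginals E (α - α') (β - β') (ψ - ψ') := by
  simpa [sub_eq_add_neg] using h.add h'.neg

theorem sum {ι : Type*} (s : Finset ι) {α : ι → I → ℝ} {β : ι → J → ℝ} {ψ : ι → I → J → ℝ}
    (h : ∀ k ∈ s, HasMarginals E (α k) (β k) (ψ k)) :
    HasMarginals E (∑ k ∈ s, α k) (∑ k ∈ s, β k) (∑ k ∈ s, ψ k) := by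
  classical
  induction s using Finset.induction_on with
  | empty => simpa using zero
  | insert k s hk ih =>
    rw [Finset.sum_insert hk, Finset.sum_insert hk, Finset.sum_insert hk]
    exact (h k (by simp)).add (ih fun l hl => h l (by simp [hl]))

/-- Writing `ψ = p + q` on the edges makes `∑ ψ²` a combination of row and column sums, which all
vanish. -/
theorem eq_zero (hE : (bipartiteGraph E).IsTree) (h : HasMarginals E 0 0 ψ) : ψ = 0 := by
  obtain ⟨p, q, hpq⟩ := exists_add_potential hE ψ
  have hterm : ∀ i j, ψ i j * ψ i j = p i * ψ i j + q j * ψ i j := by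
    intro i j
    by_cases hij : (i, j) ∈ E
    · rw [← add_mul, hpq i j hij]
    · simp [h.1 i j hij]
  have hs : ∑ i, ∑ j, ψ i j * ψ i j = 0 := by
    simp_rw [hterm, Finset.sum_add_distrib]
    rw [Finset.sum_comm (f := fun i j => q j * ψ i j)]
    simp [← Finset.mul_sum, h.2.1, h.2.2]
  ext i j
  have h1 := (Finset.sum_eq_zero_iff_of_nonneg fun i _ =>
    Finset.sum_nonneg fun j _ => mul_self_nonneg (ψ i j)).1 hs i (Finset.mem_univ i)
  have h2 := (Finset.sum_eq_zero_iff_of_nonneg fun j _ =>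
    mul_self_nonneg (ψ i j)).1 h1 j (Finset.mem_univ j)
  simpa using h2

theorem unique (hE : (bipartiteGraph E).IsTree) (h : HasMarginals E α β ψ)
    (h' : HasMarginals E α β ψ') : ψ = ψ' :=
  sub_eq_zero.1 (eq_zero hE (by simpa using h.sub h'))

theorem psi_eq (hE : (bipartiteGraph E).IsTree) (h : HasMarginals E α β ψ) :
    Psi E α β = ψ := by
  have hex : ∃ ψ, HasMarginals E α β ψ := ⟨ψ, h⟩
  rw [Psi, dif_pos hex]
  exact hex.choose_spec.unique hE h

end HasMarginals

/-! ### Existence of arrays with given marginals -/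

variable [DecidableEq I] [DecidableEq J]

theorem hasMarginals_single {i : I} {j : J} (h : (i, j) ∈ E) :
    HasMarginals E (Pi.single i 1) (Pi.single j 1) (Pi.single i (Pi.single j 1)) := by
  refine ⟨fun k l hkl => ?_, fun k => ?_, fun l => ?_⟩
  · rcases eq_or_ne k i with rfl | hk
    · rcases eq_or_ne l j with rfl | hl
      · exact absurd h hkl
      · simp [hl]
    · simp [hk]
  · rcases eq_or_ne k i with rfl | hk
    · simp
    · simp [hk]
  · rw [Finset.sum_eq_single i (fun k _ hk => by simp [hk]) (by simp)]
    simp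

/-- The boundary of a vertex of the bipartite graph: an edge has as marginals the difference of
the boundaries of its end points. -/
def vertexMarginals : I ⊕ J → (I → ℝ) × (J → ℝ)
  | Sum.inl i => (Pi.single i 1, 0)
  | Sum.inr j => (0, -Pi.single j 1)

/-- Signed unit flows on the edges of a walk telescope to the difference of its end points. -/
theorem exists_hasMarginals_of_reachable {u v : I ⊕ J} (h : (bipartiteGraph E).Reachable u v) :
    ∃ ψ, HasMarginals E ((vertexMarginals u).1 - (vertexMarginals v).1)
      ((vertexMarginals u).2 - (vertexMarginals v).2) ψ := by
  obtain ⟨p⟩ := h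
  induction p with
  | nil => exact ⟨0, by simpa using HasMarginals.zero⟩
  | @cons a b c hab _ ih =>
    obtain ⟨ψ, hψ⟩ := ih
    obtain ⟨φ, hφ⟩ : ∃ φ, HasMarginals E ((vertexMarginals a).1 - (vertexMarginals b).1)
        ((vertexMarginals a).2 - (vertexMarginals b).2) φ := by
      rcases hab with ⟨i, j, rfl, rfl, hij⟩ | ⟨i, j, rfl, rfl, hij⟩
      · exact ⟨_, by simpa [vertexMarginals] using hasMarginals_single hij⟩
      · exact ⟨_, by simpa [vertexMarginals] using (hasMarginals_single hij).neg⟩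
    exact ⟨φ + ψ, by simpa using hφ.add hψ⟩

theorem exists_hasMarginals_single (hE : (bipartiteGraph E).IsTree) (i : I) (j : J) :
    ∃ ψ, HasMarginals E (Pi.single i 1) (Pi.single j 1) ψ := by
  simpa [vertexMarginals] using
    exists_hasMarginals_of_reachable (hE.connected (Sum.inl i) (Sum.inr j))

theorem exists_hasMarginals_single_sub (hE : (bipartiteGraph E).IsTree) (j j₀ : J) :
    ∃ ψ, HasMarginals E (0 : I → ℝ) (Pi.single j 1 - Pi.single j₀ 1) ψ := by
  simpa [vertexMarginals, neg_add_eq_sub] using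
    exists_hasMarginals_of_reachable (hE.connected (Sum.inr j₀) (Sum.inr j))

theorem sum_smul_single {K : Type*} [Fintype K] [DecidableEq K] (a : K → ℝ) :
    ∑ k, a k • (Pi.single k 1 : K → ℝ) = a := by
  ext l
  simp [Finset.sum_apply, Pi.single_apply]

/-- The array with given marginals as a combination of arrays with unit marginals. -/
theorem hasMarginals_combination {j₀ : J} {φ : I → I → J → ℝ} {χ : J → I → J → ℝ}
    (hφ : ∀ i, HasMarginals E (Pi.single i 1) (Pi.single j₀ 1) (φ i))
    (hχ : ∀ j, HasMarginals E 0 (Pi.single j 1 - Pi.single j₀ 1) (χ j))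
    {α : I → ℝ} {β : J → ℝ} (h : ∑ i, α i = ∑ j, β j) :
    HasMarginals E α β (∑ i, α i • φ i + ∑ j, β j • χ j) := by
  have := (HasMarginals.sum Finset.univ fun i _ => (hφ i).smul (α i)).add
    (HasMarginals.sum Finset.univ fun j _ => (hχ j).smul (β j))
  convert this using 1
  · simp [sum_smul_single]
  · simp_rw [smul_sub]
    rw [Finset.sum_sub_distrib, sum_smul_single, ← Finset.sum_smul, ← Finset.sum_smul, h]
    abel

theorem exists_hasMarginals (hE : (bipartiteGraph E).IsTree) (j₀ : J) {α : I → ℝ} {β : J → ℝ}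
    (h : ∑ i, α i = ∑ j, β j) : ∃ ψ, HasMarginals E α β ψ := by
  choose φ hφ using fun i => exists_hasMarginals_single hE i j₀
  choose χ hχ using fun j => exists_hasMarginals_single_sub hE j j₀
  exact ⟨_, hasMarginals_combination hφ hχ h⟩

theorem hasMarginals_psi (hE : (bipartiteGraph E).IsTree) (j₀ : J) {α : I → ℝ} {β : J → ℝ}
    (h : ∑ i, α i = ∑ j, β j) : HasMarginals E α β (Psi E α β) := by
  obtain ⟨ψ, hψ⟩ := exists_hasMarginals hE j₀ h
  rwa [hψ.psi_eq hE]

/-! ### Service rates and their matrices -/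

/-- The total service rate of every class under the allocation `ψ`. -/
def serviceRate (E : Finset (I × J)) (μ : I → J → ℝ) : (I → J → ℝ) →ₗ[ℝ] I → ℝ where
  toFun ψ i := ∑ j ∈ pools E i, μ i j * ψ i j
  map_add' ψ φ := by ext i; simp [mul_add, Finset.sum_add_distrib]
  map_smul' c ψ := by
    ext i
    simp only [Pi.smul_apply, smul_eq_mul, Finset.mul_sum, RingHom.id_apply]
    exact Finset.sum_congr rfl fun j _ => by ring

theorem serviceRate_apply_of_supportedOn (μ : I → J → ℝ) {ψ : I → J → ℝ}
    (hψ : ψ ∈ supportedOn E) (i : I) : serviceRate E μ ψ i = ∑ j, μ i j * ψ i j := by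
  change ∑ j ∈ pools E i, μ i j * ψ i j = _
  refine Finset.sum_subset (Finset.subset_univ _) fun j _ hj => ?_
  rw [hψ i j (by simpa [pools] using hj), mul_zero]

/-- `B₁ α + B₂ β` is the service rate of the array with marginals `α`, `β`, and column `j₀` of `B₂`
vanishes. -/
theorem exists_matrix_serviceRate (hE : (bipartiteGraph E).IsTree) (μ : I → J → ℝ) (j₀ : J) :
    ∃ (B₁ : Matrix I I ℝ) (B₂ : Matrix I J ℝ),
      (∀ α β ψ, HasMarginals E α β ψ → serviceRate E μ ψ = B₁ *ᵥ α + B₂ *ᵥ β) ∧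
      ∀ i, B₂ i j₀ = 0 := by
  choose φ hφ using fun i => exists_hasMarginals_single hE i j₀
  choose χ hχ using fun j => exists_hasMarginals_single_sub hE j j₀
  -- Column `k` of `B₁` is the rate of the unit flow with marginals at `k` and `j₀`; column `j` of
  -- `B₂` corrects for moving the column mass from `j₀` to `j`.
  refine ⟨.of fun i k => serviceRate E μ (φ k) i, .of fun i j => serviceRate E μ (χ j) i, ?_, ?_⟩
  · intro α β ψ h
    have hs : ∑ i, α i = ∑ j, β j := by
      simp_rw [← h.2.1, ← h.2.2]
      exact Finset.sum_comm
    rw [h.unique hE (hasMarginals_combination hφ hχ hs)]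
    ext i
    simp [mulVec, dotProduct, Finset.sum_apply, mul_comm]
  · intro i
    have hz : χ j₀ = 0 := (by simpa using hχ j₀ : HasMarginals E 0 0 (χ j₀)).eq_zero hE
    simp [hz]

/-- For a representation of the service rates by matrices, `B₁` is invertible and
`1 + ⟨e, B₁⁻¹ B₂ u⟩` is bounded below by a positive constant on the simplex. -/
theorem isUnit_det_and_exists_lower_bound [Nonempty I] (hE : (bipartiteGraph E).IsTree)
    {μ : I → J → ℝ} (hμ : ∀ i j, (i, j) ∈ E → 0 < μ i j) {j₀ : J}
    {B₁ : Matrix I I ℝ} {B₂ : Matrix I J ℝ}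
    (hB : ∀ i j ψ, HasMarginals E (Pi.single i 1) (Pi.single j 1) ψ →
      serviceRate E μ ψ = B₁ *ᵥ Pi.single i 1 + B₂ *ᵥ Pi.single j 1)
    (h₀ : ∀ i, B₂ i j₀ = 0) :
    IsUnit B₁.det ∧ ∃ c : ℝ, 0 < c ∧ ∀ us ∈ stdSimplex ℝ J,
      c ≤ 1 + (1 : I → ℝ) ⬝ᵥ (B₁⁻¹ *ᵥ (B₂ *ᵥ us)) := by
  obtain ⟨v, d, hd, hd₀, hvd⟩ := exists_balancing hE hμ j₀
  have hB₂ : B₂ *ᵥ Pi.single j₀ 1 = 0 := by ext i; simp [h₀]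
  have hterm : ∀ ψ ∈ supportedOn E, ∀ i j, v i * (μ i j * ψ i j) = d j * ψ i j := by
    intro ψ hψ i j
    by_cases hij : (i, j) ∈ E
    · rw [← mul_assoc, hvd i j hij]
    · simp [hψ i j hij]
  have hrow : ∀ ψ ∈ supportedOn E, ∀ i, v i * serviceRate E μ ψ i = ∑ j, d j * ψ i j := by
    intro ψ hψ i
    rw [serviceRate_apply_of_supportedOn μ hψ, Finset.mul_sum]
    exact Finset.sum_congr rfl fun j _ => hterm ψ hψ i j
  have hdual : ∀ α β ψ, HasMarginals E α β ψ → v ⬝ᵥ serviceRate E μ ψ = d ⬝ᵥ β := by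
    intro α β ψ h
    simp only [dotProduct, hrow ψ h.1]
    rw [Finset.sum_comm]
    simp [← Finset.mul_sum, h.2.2]
  have hunit : ∀ i j, v ⬝ᵥ (B₁ *ᵥ Pi.single i 1) + v ⬝ᵥ (B₂ *ᵥ Pi.single j 1) = d j := by
    intro i j
    obtain ⟨ψ, hψ⟩ := exists_hasMarginals_single hE i j
    rw [← dotProduct_add, ← hB i j ψ hψ, hdual _ _ _ hψ]
    simp
  have hv₁ : ∀ i, v ⬝ᵥ (B₁ *ᵥ Pi.single i 1) = 1 := by
    intro i
    simpa [hB₂, hd₀] using hunit i j₀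
  have hv₂ : ∀ j, v ⬝ᵥ (B₂ *ᵥ Pi.single j 1) = d j - 1 := by
    intro j
    obtain ⟨i⟩ := ‹Nonempty I›
    linarith [hunit i j, hv₁ i]
  have hvB₁ : v ᵥ* B₁ = 1 := by
    ext i
    have := hv₁ i
    rwa [dotProduct_mulVec, dotProduct_single_one] at this
  have hvB₂ : v ᵥ* B₂ = d - 1 := by
    ext j
    have := hv₂ j
    rwa [dotProduct_mulVec, dotProduct_single_one] at this
  have hdet : B₁.det ≠ 0 := by
    intro h
    obtain ⟨α, hα, hz⟩ := Matrix.exists_mulVec_eq_zero_iff.2 h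
    choose φ hφ using fun i => exists_hasMarginals_single hE i j₀
    have hψ := HasMarginals.sum Finset.univ fun i _ => (hφ i).smul (α i)
    rw [sum_smul_single] at hψ
    set ψ := ∑ i, α i • φ i with hψdef
    have hrate : serviceRate E μ ψ = 0 := by
      have : ∀ i, serviceRate E μ (φ i) = B₁ *ᵥ Pi.single i 1 := fun i => by
        rw [hB i j₀ _ (hφ i), hB₂, add_zero]
      rw [hψdef, map_sum]
      simp_rw [map_smul, this, ← mulVec_smul]
      rw [← mulVec_sum, sum_smul_single, hz]
    have hsum : ∑ i, α i = 0 := by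
      have := hdual _ _ _ hψ
      rw [hrate, ← Finset.sum_smul] at this
      simpa [hd₀] using this.symm
    rw [← Finset.sum_smul, hsum, zero_smul] at hψ
    -- Row `i` sums to `v i` times the vanishing service rate; column `j` sums to `d j` times a zero
    -- column sum of `ψ`.
    have hbal : HasMarginals E 0 0 fun i j => d j * ψ i j :=
      ⟨fun i j hij => by simp [hψ.1 i j hij],
        fun i => by rw [← hrow ψ hψ.1, hrate]; simp,
        fun j => by simp [← Finset.mul_sum, hψ.2.2]⟩
    have hψ0 : ψ = 0 := by
      ext i j
      have := congrFun (congrFun (hbal.eq_zero hE) i) j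
      simpa [(hd j).ne'] using this
    exact hα (funext fun i => by rw [← hψ.2.1 i, hψ0]; simp)
  have hu : IsUnit B₁.det := isUnit_iff_ne_zero.2 hdet
  refine ⟨hu, ?_⟩
  obtain ⟨m, -, hm⟩ := Finset.exists_min_image Finset.univ d ⟨j₀, Finset.mem_univ _⟩
  refine ⟨d m, hd m, fun us hus => ?_⟩
  have key : 1 + (1 : I → ℝ) ⬝ᵥ (B₁⁻¹ *ᵥ (B₂ *ᵥ us)) = ∑ j, d j * us j := by
    rw [← hvB₁, ← dotProduct_mulVec, mulVec_mulVec, mul_nonsing_inv _ hu, one_mulVec,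
      dotProduct_mulVec, hvB₂, sub_dotProduct, one_dotProduct, hus.2]
    simp [dotProduct]
  rw [key]
  calc d m = ∑ j, d m * us j := by rw [← Finset.mul_sum, hus.2, mul_one]
    _ ≤ ∑ j, d j * us j := Finset.sum_le_sum fun j _ =>
      mul_le_mul_of_nonneg_right (hm j (Finset.mem_univ j)) (hus.1 j)

end Marginals

/-! ### Application to the limiting and prelimit drifts -/

namespace Network

variable {I J : Type*} [Fintype I] [Fintype J] [DecidableEq I] [DecidableEq J]

theorem nonempty_classes (S : Network I J) (j : J) : Nonempty I := by
  by_contra h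
  rw [not_nonempty_iff] at h
  simpa using S.ξ_sum j

variable (S : Network I J)

theorem drift_eq (x uc : I → ℝ) (us : J → ℝ) :
    S.drift x uc us = S.h - serviceRate S.E S.μ
      (Psi S.E (x - (∑ k, x k)⁺ • uc) (-((∑ k, x k)⁻ • us))) := rfl

theorem exists_isDriftPair (j₀ : J) : ∃ B₁ B₂, S.IsDriftPair j₀ B₁ B₂ := by
  obtain ⟨B₁, B₂, hB, h₀⟩ := exists_matrix_serviceRate S.isTree S.μ j₀
  refine ⟨B₁, B₂, fun x uc huc us hus => ?_, h₀⟩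
  -- Both sides equal `-⟨e, x⟩⁻`, since `a - a⁺ = -a⁻`.
  have hs : ∑ i, (x - (∑ k, x k)⁺ • uc) i = ∑ j, (-((∑ k, x k)⁻ • us)) j := by
    simp only [Pi.sub_apply, Pi.smul_apply, Pi.neg_apply, smul_eq_mul, Finset.sum_sub_distrib,
      Finset.sum_neg_distrib, ← Finset.mul_sum, huc.2, hus.2, mul_one]
    linarith [posPart_sub_negPart (∑ k, x k)]
  rw [drift_eq, hB _ _ _ (hasMarginals_psi S.isTree j₀ hs), mulVec_neg, mulVec_smul]
  abel

theorem exists_isPrelimitDriftPair (n : ℕ) (j₀ : J) :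
    ∃ B₁ B₂, S.IsPrelimitDriftPair n j₀ B₁ B₂ := by
  obtain ⟨B₁, B₂, hB, h₀⟩ := exists_matrix_serviceRate S.isTree (S.μN n) j₀
  exact ⟨B₁, B₂, fun α β h i =>
    congrFun (hB _ _ _ (hasMarginals_psi S.isTree j₀ h)) i, h₀⟩

variable {S}

theorem IsDriftPair.serviceRate_single {j₀ : J} {B₁ : Matrix I I ℝ} {B₂ : Matrix I J ℝ}
    (h : S.IsDriftPair j₀ B₁ B₂) (i : I) (j : J) (ψ : I → J → ℝ)
    (hψ : HasMarginals S.E (Pi.single i 1) (Pi.single j 1) ψ) :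
    serviceRate S.E S.μ ψ = B₁ *ᵥ Pi.single i 1 + B₂ *ᵥ Pi.single j 1 := by
  -- At `x = -eᵢ` the positive part vanishes and the negative part is `1`, so `uᶜ` drops out and `uˢ
  -- = eⱼ` yields the unit marginals up to sign.
  have hx : ∑ k, (-Pi.single i 1 : I → ℝ) k = -1 := by simp
  have := h.1 (-Pi.single i 1) _ (single_mem_stdSimplex ℝ i) _ (single_mem_stdSimplex ℝ j)
  rw [drift_eq, hx, posPart_eq_zero.2 (by norm_num), negPart_eq_neg.2 (by norm_num), neg_neg,
    zero_smul, sub_zero, one_smul, one_smul, hψ.neg.psi_eq S.isTree, map_neg, mulVec_neg] at this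
  have h2 : S.h + serviceRate S.E S.μ ψ
      = S.h + (B₁ *ᵥ Pi.single i 1 + B₂ *ᵥ Pi.single j 1) := by
    simpa [add_assoc] using this
  exact add_left_cancel h2

theorem IsPrelimitDriftPair.serviceRate_single {n : ℕ} {j₀ : J} {B₁ : Matrix I I ℝ}
    {B₂ : Matrix I J ℝ} (h : S.IsPrelimitDriftPair n j₀ B₁ B₂) (i : I) (j : J) (ψ : I → J → ℝ)
    (hψ : HasMarginals S.E (Pi.single i 1) (Pi.single j 1) ψ) :
    serviceRate S.E (S.μN n) ψ = B₁ *ᵥ Pi.single i 1 + B₂ *ᵥ Pi.single j 1 := by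
  ext k
  have := h.1 (Pi.single i 1) (Pi.single j 1) (by simp) k
  rwa [hψ.psi_eq S.isTree] at this

end Network

end PSN

theorem lemma2 {I J : Type*} [Fintype I] [Fintype J] [DecidableEq I] [DecidableEq J]
    (S : PSN.Network I J) (j₀ : J) :
    ((∃ B₁ B₂, S.IsDriftPair j₀ B₁ B₂) ∧
      ∀ B₁ B₂, S.IsDriftPair j₀ B₁ B₂ →
        IsUnit B₁.det ∧
        ∃ c : ℝ, 0 < c ∧ ∀ us ∈ stdSimplex ℝ J,
          c ≤ 1 + (1 : I → ℝ) ⬝ᵥ (B₁⁻¹ *ᵥ (B₂ *ᵥ us))) ∧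
    ∀ n : ℕ, 1 ≤ n →
      ((∃ B₁ B₂, S.IsPrelimitDriftPair n j₀ B₁ B₂) ∧
        ∀ B₁ B₂, S.IsPrelimitDriftPair n j₀ B₁ B₂ →
          IsUnit B₁.det ∧
          ∃ c : ℝ, 0 < c ∧ ∀ us ∈ stdSimplex ℝ J,
            c ≤ 1 + (1 : I → ℝ) ⬝ᵥ (B₁⁻¹ *ᵥ (B₂ *ᵥ us))) := by
  have := S.nonempty_classes j₀
  exact ⟨⟨S.exists_isDriftPair j₀, fun _ _ h =>
      PSN.isUnit_det_and_exists_lower_bound S.isTree S.μ_pos h.serviceRate_single h.2⟩,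
    fun n hn => ⟨S.exists_isPrelimitDriftPair n j₀, fun _ _ h =>
      PSN.isUnit_det_and_exists_lower_bound S.isTree (S.μN_pos n hn) h.serviceRate_single h.2⟩⟩
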